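/- Let $D=(V,A)$ be a finite digraph with lower and upper bound functions $f:A\to\mathbb{Z}\cup\{-\infty\}$ and $g:A\to\mathbb{Z}\cup\{+\infty\}$ such that $f\le g$, and let $m:V\to\mathbb{Z}$ satisfy $\sum_{v\in V}m(v)=0$. An integral $m$-flow is a function $x:A\to\mathbb{Z}$ such that, for every node $v$, the sum of $x$ over the edges entering $v$ minus the sum of $x$ over the edges leaving $v$ equals $m(v)$; it is $(f,g)$-bounded if $f\le x\le g$. Let $F\subseteq A$. An integral $(f,g)$-bounded $m$-flow $z$ is called decreasingly minimal on $F$ ($F$-dec-min) if there is no integral $(f,g)$-bounded $m$-flow $y$ for which the sequence of the values $y(e)$ $(e\in F)$, arranged in decreasing order, is lexicographically strictly smaller than the sequence of the values $z(e)$ $(e\in F)$, arranged in decreasing order. Assume that there exists an $F$-dec-min integral $(f,g)$-bounded $m$-flow. Then there exist functions $f^*:A\to\mathbb{Z}\cup\{-\infty\}$ and $g^*:A\to\mathbb{Z}\cup\{+\infty\}$ with $f\le f^*\le g^*\le g$ such that 1. for every $e\in F$, both $f^*(e)$ and $g^*(e)$ are finite and $0\le g^*(e)-f^*(e)\le 1$;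 and 2. a function $z:A\to\mathbb{Z}$ is an $F$-dec-min integral $(f,g)$-bounded $m$-flow if and only if $z$ is an integral $(f^*,g^*)$-bounded $m$-flow. -/

import Mathlib

/-- A directed graph with node-set `V` and edge-set `A`; parallel edges and loops are allowed.
The edge `a` goes from `tail a` to `head a`. -/
structure DiGr (V A : Type*) where
  tail : A → V
  head : A → V

namespace DiGr

variable {V A : Type*} [DecidableEq V] [Fintype A]

/-- The total value of `x` on the edges entering `v`. -/
def inSum (D : DiGr V A) (x : A → ℤ) (v : V) : ℤ :=
  ∑ a ∈ Finset.univ.filter (fun a => D.head a = v), x a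

/-- The total value of `x` on the edges leaving `v`. -/
def outSum (D : DiGr V A) (x : A → ℤ) (v : V) : ℤ :=
  ∑ a ∈ Finset.univ.filter (fun a => D.tail a = v), x a

/-- `x` is an integral `m`-flow (modular flow with respect to `m`). -/
def IsModFlow (D : DiGr V A) (m : V → ℤ) (x : A → ℤ) : Prop :=
  ∀ v : V, D.inSum x v - D.outSum x v = m v

end DiGr

/-- `p ≤ q` for a lower bound `p ∈ ℤ ∪ {-∞}` and an upper bound `q ∈ ℤ ∪ {+∞}`. -/
def LowerLEUpper (p : WithBot ℤ) (q : WithTop ℤ) : Prop :=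
  ∀ k l : ℤ, p = (k : WithBot ℤ) → q = (l : WithTop ℤ) → k ≤ l

/-- The integral vector `x` lies in the box `T(f, g)`, that is, `f ≤ x ≤ g`. -/
def IsBoxBounded {A : Type*} (f : A → WithBot ℤ) (g : A → WithTop ℤ) (x : A → ℤ) : Prop :=
  ∀ a : A, f a ≤ ((x a : ℤ) : WithBot ℤ) ∧ ((x a : ℤ) : WithTop ℤ) ≤ g a

/-- The set of integral `(f, g)`-bounded `m`-flows. -/
def intFlows {V A : Type*} [DecidableEq V] [Fintype A] (D : DiGr V A)
    (f : A → WithBot ℤ) (g : A → WithTop ℤ) (m : V → ℤ) : Set (A → ℤ) :=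
  {x | D.IsModFlow m x ∧ IsBoxBounded f g x}

/-- The components of `x` on `F` (with multiplicity), arranged in decreasing order. -/
def decSeq {A : Type*} (F : Finset A) (x : A → ℤ) : List ℤ :=
  (F.val.map x).sort (fun i j => i ≥ j)

/-- `y` is decreasingly smaller than `x` on `F`: the decreasing rearrangement of `y` on `F`
is lexicographically strictly smaller than that of `x`. -/
def DecSmallerOn {A : Type*} (F : Finset A) (y x : A → ℤ) : Prop :=
  List.Lex (fun i j : ℤ => i < j) (decSeq F y) (decSeq F x)

/-- `z` is an element of `Q` that is decreasingly minimal on `F`. -/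
def IsDecMinOn {A : Type*} (Q : Set (A → ℤ)) (F : Finset A) (z : A → ℤ) : Prop :=
  z ∈ Q ∧ ∀ y ∈ Q, ¬ DecSmallerOn F y z

/-!
For integral vectors, being decreasingly smaller on `F` is the same as having a smaller value of the
separable cost `∑ e ∈ F, N ^ x e`, as soon as `N ≥ 1` and `N > |F|`
(`decSmallerOn_iff`). Hence the decreasingly minimal flows are exactly the flows minimizing a
separable convex cost; for `N ≥ 2` its components are strictly convex on `F`, and they are zero
off `F`.

Let `z` be a minimizing flow. A closed walk in the residual digraph of `z` that repeats no arc can be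
pushed through `z`, so its cost, the sum of the unit increments of the cost function along its arcs,
is nonnegative (`residual_closed_walk_nonneg`). A digraph without negative closed walks has a
potential `π` (`exists_potential`), namely the infimum of the costs of the walks ending at a node.
Adding `(π (tail a) - π (head a)) * x a` to the cost of each edge `a` changes the total cost of every
`m`-flow by the same constant (`sum_potential_mul`), and by convexity each `z a` then minimizes the
reduced cost of its own edge over the interval from `f a` to `g a`. So an `m`-flow within the bounds
is a minimizer iff each of its components minimizes the reduced cost of its edge. The minimizers on
one edge form an interval, which has at most two points if the reduced cost is strictly convex
(`exists_argmin_interval`), and is a single point or the whole interval if it is linear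
(`exists_argmin_interval_linear`). These intervals are the bounds sought.
-/

/-! ### Walks and potentials -/

/-- The list `l` of arcs, all from the set `R`, is a walk from `u` to `v`, where the arc `e` goes
from `s e` to `t e`. -/
def IsArcWalk {V E : Type*} (s t : E → V) (R : Set E) : V → List E → V → Prop
  | u, [], v => u = v
  | u, e :: l, v => e ∈ R ∧ s e = u ∧ IsArcWalk s t R (t e) l v

namespace IsArcWalk

variable {V E : Type*} {s t : E → V} {R : Set E}

theorem append_iff {l₁ l₂ : List E} {u v : V} :
    IsArcWalk s t R u (l₁ ++ l₂) v ↔ ∃ x, IsArcWalk s t R u l₁ x ∧ IsArcWalk s t R x l₂ v := by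
  induction l₁ generalizing u with
  | nil => simp [IsArcWalk]
  | cons e l ih => simp [IsArcWalk, ih, and_assoc]

theorem mem {l : List E} {u v : V} (h : IsArcWalk s t R u l v) : ∀ e ∈ l, e ∈ R := by
  induction l generalizing u with
  | nil => simp
  | cons e l ih =>
    obtain ⟨h1, -, h3⟩ := h
    simpa [h1] using ih h3

/-- A walk that repeats an arc contains a shorter closed walk whose removal leaves a shorter walk. -/
theorem exists_split_of_not_nodup {l : List E} {u v : V} (h : IsArcWalk s t R u l v)
    (hl : ¬ l.Nodup) :
    ∃ (l₁ l₂ l₃ : List E) (x : V), l = l₁ ++ (l₂ ++ l₃) ∧ l₂ ≠ [] ∧ l₃ ≠ [] ∧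
      IsArcWalk s t R x l₂ x ∧ IsArcWalk s t R u (l₁ ++ l₃) v := by
  induction l generalizing u with
  | nil => simp at hl
  | cons e l ih =>
    by_cases he : e ∈ l
    · obtain ⟨a, b, rfl⟩ := List.append_of_mem he
      -- The walk returns to `u = s e` just before the second occurrence of `e`.
      obtain ⟨x, h1, h2⟩ := append_iff.1 h.2.2
      obtain rfl : u = x := h.2.1.symm.trans h2.2.1
      exact ⟨[], e :: a, e :: b, u, by simp, by simp, by simp, ⟨h.1, h.2.1, h1⟩, h2⟩
    · obtain ⟨l₁, l₂, l₃, x, rfl, h2, h3, hx, hw⟩ :=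
        ih h.2.2 (fun h' => hl (List.nodup_cons.2 ⟨he, h'⟩))
      exact ⟨e :: l₁, l₂, l₃, x, by simp, h2, h3, hx, h.1, h.2.1, hw⟩

/-- If closed walks without repeated arcs have nonnegative cost, then every walk can be replaced by
one without repeated arcs that costs no more. -/
theorem exists_nodup_le (c : E → ℝ)
    (hc : ∀ u l, IsArcWalk s t R u l u → l.Nodup → 0 ≤ (l.map c).sum)
    {l : List E} {u v : V} (h : IsArcWalk s t R u l v) :
    ∃ l', IsArcWalk s t R u l' v ∧ l'.Nodup ∧ (l'.map c).sum ≤ (l.map c).sum := by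
  induction hn : l.length using Nat.strong_induction_on generalizing l u v with
  | _ n ih =>
    by_cases hl : l.Nodup
    · exact ⟨l, h, hl, le_rfl⟩
    obtain ⟨l₁, l₂, l₃, x, rfl, h2, h3, hx, hw⟩ := h.exists_split_of_not_nodup hl
    have h2' := List.length_pos_iff.2 h2
    have h3' := List.length_pos_iff.2 h3
    simp only [List.length_append] at hn
    obtain ⟨k, hk, hkn, hkc⟩ := ih l₂.length (by omega) hx rfl
    obtain ⟨k', hk', hkn', hkc'⟩ :=
      ih (l₁ ++ l₃).length (by rw [List.length_append]; omega) hw rfl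
    refine ⟨k', hk', hkn', hkc'.trans ?_⟩
    have := hc x k hk hkn
    simp only [List.map_append, List.sum_append]
    linarith

end IsArcWalk

/-- If no closed walk without repeated arcs has negative cost, there is a potential. -/
theorem exists_potential {V E : Type*} [Finite E] (s t : E → V) (R : Set E) (c : E → ℝ)
    (hc : ∀ u l, IsArcWalk s t R u l u → l.Nodup → 0 ≤ (l.map c).sum) :
    ∃ π : V → ℝ, ∀ e ∈ R, π (t e) ≤ π (s e) + c e := by
  classical
  have := Fintype.ofFinite E
  let S : V → Set ℝ := fun v => {r | ∃ u l, IsArcWalk s t R u l v ∧ (l.map c).sum = r}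
  have hne (v : V) : (S v).Nonempty := ⟨0, v, [], rfl, by simp⟩
  have hbdd (v : V) : BddBelow (S v) := by
    refine ⟨-∑ e, |c e|, ?_⟩
    rintro _ ⟨u, l, hl, rfl⟩
    obtain ⟨l', -, hn, hle⟩ := hl.exists_nodup_le c hc
    refine le_trans ?_ hle
    rw [← List.sum_toFinset c hn, neg_le, ← Finset.sum_neg_distrib]
    calc ∑ e ∈ l'.toFinset, -c e ≤ ∑ e ∈ l'.toFinset, |c e| :=
          Finset.sum_le_sum fun e _ => neg_le_abs _
      _ ≤ ∑ e, |c e| := Finset.sum_le_univ_sum_of_nonneg fun e => abs_nonneg _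
  refine ⟨fun v => sInf (S v), fun e he => ?_⟩
  rw [← sub_le_iff_le_add]
  refine le_csInf (hne _) ?_
  rintro _ ⟨u, l, hl, rfl⟩
  rw [sub_le_iff_le_add]
  refine csInf_le (hbdd _) ⟨u, l ++ [e], IsArcWalk.append_iff.2 ⟨s e, hl, he, rfl, rfl⟩, ?_⟩
  simp

/-! ### Flows along walks of the residual digraph -/

namespace DiGr

variable {V A : Type*} (D : DiGr V A)

/-- The starting node of a residual arc: `(a, true)` stands for the edge `a`, to be increased, and
`(a, false)` for its reversal, to be decreased. -/
def arcSrc (e : A × Bool) : V := if e.2 then D.tail e.1 else D.head e.1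

/-- The end node of a residual arc. -/
def arcTgt (e : A × Bool) : V := if e.2 then D.head e.1 else D.tail e.1

/-- The arcs of the residual digraph of `z` with respect to the bounds `f` and `g`. -/
def residual (f : A → WithBot ℤ) (g : A → WithTop ℤ) (z : A → ℤ) : Set (A × Bool) :=
  {e | if e.2 then ((z e.1 + 1 : ℤ) : WithTop ℤ) ≤ g e.1 else f e.1 ≤ ((z e.1 - 1 : ℤ) : WithBot ℤ)}

/-- The change of the vector `z` when one unit is pushed along each arc of the list `l`. -/
def pushVec [DecidableEq A] (l : List (A × Bool)) (a : A) : ℤ :=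
  (l.count (a, true) : ℤ) - l.count (a, false)

/-- The change of the separable cost `φ` caused by pushing one unit along a residual arc at `z`. -/
def arcCost (φ : A → ℤ → ℝ) (z : A → ℤ) (e : A × Bool) : ℝ :=
  (if e.2 then φ e.1 (z e.1 + 1) else φ e.1 (z e.1 - 1)) - φ e.1 (z e.1)

variable [DecidableEq V] [Fintype A]

theorem inSum_add (x y : A → ℤ) (v : V) :
    D.inSum (fun a => x a + y a) v = D.inSum x v + D.inSum y v := Finset.sum_add_distrib

theorem outSum_add (x y : A → ℤ) (v : V) :
    D.outSum (fun a => x a + y a) v = D.outSum x v + D.outSum y v := Finset.sum_add_distrib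

/-- Pushing along a walk only changes the excess of its two end nodes. -/
theorem pushVec_excess [DecidableEq A] {R : Set (A × Bool)} {l : List (A × Bool)} {u w : V}
    (h : IsArcWalk D.arcSrc D.arcTgt R u l w) (v : V) :
    D.inSum (pushVec l) v - D.outSum (pushVec l) v =
      (if w = v then 1 else 0) - (if u = v then 1 else 0) := by
  induction l generalizing u with
  | nil =>
    obtain rfl : u = w := h
    simp [inSum, outSum, pushVec]
  | cons e l ih =>
    obtain ⟨-, rfl, h⟩ := h
    have hcons : pushVec (e :: l) =
        fun a => pushVec l a + if e.1 = a then (if e.2 then 1 else -1) else 0 := by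
      funext a
      obtain ⟨b, _ | _⟩ := e <;> by_cases hb : b = a <;>
        simp [pushVec, hb] <;> ring
    have := ih h
    rw [hcons, inSum_add, outSum_add]
    simp only [inSum, outSum, Finset.sum_ite_eq, Finset.mem_filter, Finset.mem_univ, true_and] at *
    obtain ⟨b, _ | _⟩ := e <;> simp [arcSrc, arcTgt] at * <;> split_ifs at * <;> linarith

/-- The node potentials contribute the same amount to the reduced cost of every `m`-flow. -/
theorem sum_potential_mul [Fintype V] {m : V → ℤ} {x : A → ℤ} (hx : D.IsModFlow m x) (π : V → ℝ) :
    ∑ a, (π (D.tail a) - π (D.head a)) * x a = -∑ v, π v * m v := by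
  have key (p : A → V) :
      ∑ v, π v * ((∑ a ∈ Finset.univ.filter (fun a => p a = v), x a : ℤ) : ℝ) =
        ∑ a, π (p a) * x a := by
    rw [← Finset.sum_fiberwise Finset.univ p]
    refine Finset.sum_congr rfl fun v _ => ?_
    push_cast
    rw [Finset.mul_sum]
    refine Finset.sum_congr rfl fun a ha => ?_
    rw [(Finset.mem_filter.1 ha).2]
  have h (v : V) : (m v : ℝ) = (D.inSum x v : ℝ) - D.outSum x v := by
    rw [← hx v]; push_cast; rfl
  simp only [h, mul_sub, Finset.sum_sub_distrib]
  rw [show ∑ v, π v * (D.inSum x v : ℝ) = _ from key D.head,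
    show ∑ v, π v * (D.outSum x v : ℝ) = _ from key D.tail]
  simp only [sub_mul, Finset.sum_sub_distrib]
  ring

/-- Pushing one unit along a closed walk of the residual digraph of `z` gives a feasible flow, whose
cost exceeds that of `z` by at most the cost of the walk; hence the latter is nonnegative if `z` is
optimal. -/
theorem residual_closed_walk_nonneg {f : A → WithBot ℤ} {g : A → WithTop ℤ} {m : V → ℤ}
    {φ : A → ℤ → ℝ} {z : A → ℤ} (hφ : ∀ a k, 2 * φ a k ≤ φ a (k + 1) + φ a (k - 1))
    (hz : z ∈ intFlows D f g m)
    (hopt : ∀ y ∈ intFlows D f g m, ∑ a, φ a (z a) ≤ ∑ a, φ a (y a))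
    {u : V} {l : List (A × Bool)}
    (h : IsArcWalk D.arcSrc D.arcTgt (residual f g z) u l u) (hl : l.Nodup) :
    0 ≤ (l.map (arcCost φ z)).sum := by
  classical
  have hcount (a : A) (b : Bool) : l.count (a, b) = if (a, b) ∈ l then 1 else 0 := hl.count
  have hpush (a : A) : pushVec l a =
      (if (a, true) ∈ l then 1 else 0) - (if (a, false) ∈ l then 1 else 0) := by
    simp [pushVec, hcount]
  have hy : (fun a => z a + pushVec l a) ∈ intFlows D f g m := by
    refine ⟨fun v => ?_, fun a => ?_⟩
    · have h1 := D.pushVec_excess h v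
      have h2 := hz.1 v
      rw [inSum_add, outSum_add]
      rw [sub_self] at h1
      linarith
    · have hza := hz.2 a
      have ht : (a, true) ∈ l → ((z a + 1 : ℤ) : WithTop ℤ) ≤ g a := fun he => h.mem _ he
      have hf : (a, false) ∈ l → f a ≤ ((z a - 1 : ℤ) : WithBot ℤ) := fun he => by
        simpa [residual] using h.mem _ he
      simp only [hpush]
      by_cases h1 : (a, true) ∈ l <;> by_cases h2 : (a, false) ∈ l <;>
        simp only [h1, h2, if_true, if_false, sub_zero, add_zero, sub_self, zero_sub,
          ← sub_eq_add_neg]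
      · exact hza
      · exact ⟨hza.1.trans (WithBot.coe_le_coe.2 (by omega)), ht h1⟩
      · exact ⟨hf h2, le_trans (WithTop.coe_le_coe.2 (by omega)) hza.2⟩
      · exact hza
  have hle := hopt _ hy
  rw [← sub_nonneg, ← Finset.sum_sub_distrib] at hle
  refine hle.trans ?_
  have hcost : (l.map (arcCost φ z)).sum = ∑ e, if e ∈ l then arcCost φ z e else 0 := by
    rw [← List.sum_toFinset _ hl, ← Finset.sum_filter]
    congr 1
    ext e
    simp
  rw [hcost, Fintype.sum_prod_type]
  refine Finset.sum_le_sum fun a _ => ?_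
  rw [Fintype.sum_bool, hpush]
  have := hφ a (z a)
  by_cases h1 : (a, true) ∈ l <;> by_cases h2 : (a, false) ∈ l <;>
    simp [h1, h2, arcCost, ← sub_eq_add_neg]
  -- If both arcs of `a` are used, the pushes cancel, and convexity bounds the cost of the pair.
  linarith

end DiGr

/-! ### Minimizers of a convex function on an integer interval -/

/-- A strictly convex function on the integers that does not decrease from `z` to `z + 1` is larger
than `ψ z` beyond `z + 1`. -/
theorem lt_of_convex_of_le_succ {ψ : ℤ → ℝ} (hψ : ∀ k, 2 * ψ k < ψ (k + 1) + ψ (k - 1)) {z : ℤ}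
    (hz : ψ z ≤ ψ (z + 1)) {x : ℤ} (hx : z + 1 < x) : ψ z < ψ x := by
  have key : ∀ y, z + 2 ≤ y → ψ z < ψ y ∧ ψ (y - 1) < ψ y := by
    intro y hy
    induction y, hy using Int.leInduction with
    | base =>
      have := hψ (z + 1)
      rw [show z + 1 + 1 = z + 2 by ring, show z + 1 - 1 = z by ring] at this
      rw [show z + 2 - 1 = z + 1 by ring]
      constructor <;> linarith
    | succ y hy ih =>
      have := hψ y
      rw [show y + 1 - 1 = y by ring]
      constructor <;> linarith [ih.1, ih.2]
  exact (key x (by omega)).1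

/-- A strictly convex function on the integers that is locally minimal at `z` among the integers
between `f` and `g` attains its minimum there exactly on an interval of at most two points. -/
theorem exists_argmin_interval {f : WithBot ℤ} {g : WithTop ℤ} {ψ : ℤ → ℝ} {z : ℤ}
    (hψ : ∀ k, 2 * ψ k < ψ (k + 1) + ψ (k - 1)) (hfz : f ≤ (z : WithBot ℤ))
    (hzg : (z : WithTop ℤ) ≤ g)
    (hsucc : ((z + 1 : ℤ) : WithTop ℤ) ≤ g → ψ z ≤ ψ (z + 1))
    (hpred : f ≤ ((z - 1 : ℤ) : WithBot ℤ) → ψ z ≤ ψ (z - 1)) :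
    ∃ k l : ℤ, f ≤ (k : WithBot ℤ) ∧ (l : WithTop ℤ) ≤ g ∧ k ≤ l ∧ l - k ≤ 1 ∧
      ∀ x : ℤ, f ≤ (x : WithBot ℤ) → (x : WithTop ℤ) ≤ g →
        ψ z ≤ ψ x ∧ (ψ x = ψ z ↔ k ≤ x ∧ x ≤ l) := by
  have hup {x : ℤ} (hx : (x : WithTop ℤ) ≤ g) (h : z + 1 < x) : ψ z < ψ x :=
    lt_of_convex_of_le_succ hψ
      (hsucc (le_trans (WithTop.coe_le_coe.2 h.le) hx)) h
  have hdown {x : ℤ} (hx : f ≤ (x : WithBot ℤ)) (h : x < z - 1) : ψ z < ψ x := by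
    -- Apply the previous bound to the reflected function.
    have := lt_of_convex_of_le_succ (ψ := fun k => ψ (-k)) (z := -z) (x := -x) (fun k => by
        have := hψ (-k)
        rw [show -(k + 1) = -k - 1 by ring, show -(k - 1) = -k + 1 by ring]
        linarith) (by
        have := hpred (hx.trans (WithBot.coe_le_coe.2 h.le))
        rw [show -(-z + 1) = z - 1 by ring, neg_neg]
        exact this) (by omega)
    simpa using this
  have hz := hψ z
  have hmin {x : ℤ} (hfx : f ≤ (x : WithBot ℤ)) (hxg : (x : WithTop ℤ) ≤ g) : ψ z ≤ ψ x := by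
    rcases lt_or_ge (z + 1) x with h | h
    · exact (hup hxg h).le
    rcases lt_or_ge x (z - 1) with h' | h'
    · exact (hdown hfx h').le
    obtain rfl | rfl | rfl : x = z + 1 ∨ x = z ∨ x = z - 1 := by omega
    · exact hsucc hxg
    · exact le_rfl
    · exact hpred hfx
  by_cases h1 : ((z + 1 : ℤ) : WithTop ℤ) ≤ g ∧ ψ (z + 1) = ψ z
  · refine ⟨z, z + 1, hfz, h1.1, by omega, by omega, fun x hfx hxg => ⟨hmin hfx hxg, fun h => ?_,
      fun h => ?_⟩⟩
    · by_contra hne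
      rcases lt_or_ge (z + 1) x with h' | h'
      · exact (hup hxg h').ne' h
      rcases lt_or_ge x (z - 1) with h'' | h''
      · exact (hdown hfx h'').ne' h
      obtain rfl : x = z - 1 := by omega
      linarith [h1.2]
    · obtain rfl | rfl : x = z ∨ x = z + 1 := by omega
      exacts [rfl, h1.2]
  by_cases h2 : f ≤ ((z - 1 : ℤ) : WithBot ℤ) ∧ ψ (z - 1) = ψ z
  · refine ⟨z - 1, z, h2.1, hzg, by omega, by omega, fun x hfx hxg => ⟨hmin hfx hxg, fun h => ?_,
      fun h => ?_⟩⟩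
    · by_contra hne
      rcases lt_or_ge (z + 1) x with h' | h'
      · exact (hup hxg h').ne' h
      rcases lt_or_ge x (z - 1) with h'' | h''
      · exact (hdown hfx h'').ne' h
      obtain rfl : x = z + 1 := by omega
      exact h1 ⟨hxg, h⟩
    · obtain rfl | rfl : x = z ∨ x = z - 1 := by omega
      exacts [rfl, h2.2]
  refine ⟨z, z, hfz, hzg, le_rfl, by omega, fun x hfx hxg => ⟨hmin hfx hxg, fun h => ?_,
    fun h => by rw [le_antisymm h.2 h.1]⟩⟩
  by_contra hne
  rcases lt_or_ge (z + 1) x with h' | h'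
  · exact (hup hxg h').ne' h
  rcases lt_or_ge x (z - 1) with h'' | h''
  · exact (hdown hfx h'').ne' h
  obtain rfl | rfl : x = z + 1 ∨ x = z - 1 := by omega
  exacts [h1 ⟨hxg, h⟩, h2 ⟨hfx, h⟩]

/-- A linear function either is constant, so that the whole interval from `f` to `g` consists of
minimizers, or has `z` as its only minimizer there. -/
theorem exists_argmin_interval_linear {f : WithBot ℤ} {g : WithTop ℤ} (hfg : LowerLEUpper f g)
    {r : ℝ} {z : ℤ} (hfz : f ≤ (z : WithBot ℤ)) (hzg : (z : WithTop ℤ) ≤ g)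
    (hsucc : ((z + 1 : ℤ) : WithTop ℤ) ≤ g → r * z ≤ r * (z + 1 : ℤ))
    (hpred : f ≤ ((z - 1 : ℤ) : WithBot ℤ) → r * z ≤ r * (z - 1 : ℤ)) :
    ∃ (f' : WithBot ℤ) (g' : WithTop ℤ), f ≤ f' ∧ g' ≤ g ∧ LowerLEUpper f' g' ∧
      ∀ x : ℤ, f ≤ (x : WithBot ℤ) → (x : WithTop ℤ) ≤ g →
        r * z ≤ r * x ∧ (r * x = r * z ↔ f' ≤ (x : WithBot ℤ) ∧ (x : WithTop ℤ) ≤ g') := by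
  rcases eq_or_ne r 0 with rfl | hr
  · exact ⟨f, g, le_rfl, le_rfl, hfg, fun x hfx hxg => by simp [hfx, hxg]⟩
  refine ⟨z, z, hfz, hzg, fun k l hk hl => ?_, fun x hfx hxg => ⟨?_, ?_⟩⟩
  · rw [← WithBot.coe_injective hk, ← WithTop.coe_injective hl]
  · rcases lt_trichotomy x z with h | rfl | h
    · have h1 := hpred (hfx.trans (WithBot.coe_le_coe.2 (by omega)))
      have h2 : (x : ℝ) ≤ z := by exact_mod_cast h.le
      push_cast at h1
      nlinarith
    · exact le_rfl
    · have h1 := hsucc (le_trans (WithTop.coe_le_coe.2 (by omega)) hxg)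
      have h2 : (z : ℝ) ≤ x := by exact_mod_cast h.le
      push_cast at h1
      nlinarith
  · rw [mul_right_inj' hr, Int.cast_inj, WithBot.coe_le_coe, WithTop.coe_le_coe]
    omega

/-! ### Decreasing minimality as minimality of a separable convex cost -/

theorem sum_zpow_le_of_forall_le {N : ℝ} (hN : 1 ≤ N) (l : List ℤ) (i : ℤ) (h : ∀ j ∈ l, j ≤ i) :
    (l.map (fun k => N ^ k)).sum ≤ l.length * N ^ i := by
  have := List.sum_le_card_nsmul (l.map (fun k => N ^ k)) (N ^ i) (by
    simp only [List.mem_map]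
    rintro _ ⟨j, hj, rfl⟩
    exact zpow_le_zpow_right₀ hN (h j hj))
  simpa using this

/-- At the first difference of two decreasing lists, a smaller exponent `a` bounds all later ones,
so from there on that list contributes less than `N * N ^ a`, which the other list reaches with one term. -/
theorem sum_zpow_lt_of_lex {N : ℝ} {l₁ l₂ : List ℤ} (hlen : l₁.length = l₂.length)
    (hN1 : 1 ≤ N) (hN : (l₁.length : ℝ) < N) (hl : l₁.Pairwise (fun i j => i ≥ j))
    (h : List.Lex (fun i j : ℤ => i < j) l₁ l₂) :
    (l₁.map (fun k => N ^ k)).sum < (l₂.map (fun k => N ^ k)).sum := by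
  have hN0 : 0 < N := by linarith
  induction h with
  | nil => simp at hlen
  | @cons a l₁ l₂ h ih =>
    simp only [List.length_cons, Nat.cast_add, Nat.cast_one, add_left_inj] at hlen hN
    simpa using ih hlen (by linarith) (List.pairwise_cons.1 hl).2
  | @rel a l₁ b l₂ hab =>
    have h1 := sum_zpow_le_of_forall_le hN1 (a :: l₁) a (by
      simpa using (List.pairwise_cons.1 hl).1)
    have h2 : N ^ (a + 1) ≤ N ^ b := zpow_le_zpow_right₀ hN1 hab
    have h3 : 0 ≤ (l₂.map (fun k => N ^ k)).sum := by
      refine List.sum_nonneg ?_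
      simp only [List.mem_map]
      rintro _ ⟨j, -, rfl⟩
      positivity
    rw [zpow_add_one₀ hN0.ne'] at h2
    have h4 : 0 < N ^ a := by positivity
    rw [List.map_cons (l := l₂), List.sum_cons]
    nlinarith

theorem lex_or_eq_or_lex : ∀ l₁ l₂ : List ℤ, l₁.length = l₂.length →
    List.Lex (fun i j : ℤ => i < j) l₁ l₂ ∨ l₁ = l₂ ∨ List.Lex (fun i j : ℤ => i < j) l₂ l₁
  | [], [], _ => Or.inr (Or.inl rfl)
  | a :: l₁, b :: l₂, h => by
    rcases lt_trichotomy a b with hab | rfl | hab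
    · exact Or.inl (List.Lex.rel hab)
    · rcases lex_or_eq_or_lex l₁ l₂ (by simpa using h) with h | rfl | h
      · exact Or.inl (List.Lex.cons h)
      · exact Or.inr (Or.inl rfl)
      · exact Or.inr (Or.inr (List.Lex.cons h))
    · exact Or.inr (Or.inr (List.Lex.rel hab))

theorem decSmallerOn_iff {A : Type*} {F : Finset A} {N : ℝ} (hN1 : 1 ≤ N) (hN : (F.card : ℝ) < N)
    (y x : A → ℤ) : DecSmallerOn F y x ↔ ∑ e ∈ F, N ^ y e < ∑ e ∈ F, N ^ x e := by
  have hlen (x : A → ℤ) : (decSeq F x).length = F.card := by simp [decSeq]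
  have hsum (x : A → ℤ) : ((decSeq F x).map (fun k => N ^ k)).sum = ∑ e ∈ F, N ^ x e := by
    rw [← Multiset.sum_coe, ← Multiset.map_coe, decSeq, Multiset.sort_eq, Multiset.map_map]
    rfl
  have hmono (y x : A → ℤ) (h : DecSmallerOn F y x) : ∑ e ∈ F, N ^ y e < ∑ e ∈ F, N ^ x e := by
    rw [← hsum, ← hsum]
    exact sum_zpow_lt_of_lex (by rw [hlen, hlen]) hN1 (by rwa [hlen])
      (Multiset.pairwise_sort _ _) h
  refine ⟨hmono y x, fun h => ?_⟩
  rcases lex_or_eq_or_lex (decSeq F y) (decSeq F x) (by rw [hlen, hlen]) with h' | h' | h'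
  · exact h'
  · rw [← hsum, ← hsum, h'] at h
    exact absurd h (lt_irrefl _)
  · exact absurd h (hmono x y h').not_gt

theorem two_mul_zpow_lt {N : ℝ} (hN : 2 ≤ N) (k : ℤ) : 2 * N ^ k < N ^ (k + 1) + N ^ (k - 1) := by
  have h0 : N ≠ 0 := by positivity
  have h1 : 0 < N ^ (k - 1) := by positivity
  have h2 : N ^ k = N ^ (k - 1) * N := by rw [← zpow_add_one₀ h0, sub_add_cancel]
  have h3 : 0 < N ^ (k - 1) * (N - 1) ^ 2 := mul_pos h1 (pow_pos (by linarith) 2)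
  rw [zpow_add_one₀ h0, h2]
  linarith

/-! ### The box of decreasingly minimal flows -/

theorem mainTheorem3 {V A : Type*} [Fintype V] [DecidableEq V] [Fintype A]
    (D : DiGr V A) (f : A → WithBot ℤ) (g : A → WithTop ℤ)
    (hfg : ∀ a : A, LowerLEUpper (f a) (g a))
    (m : V → ℤ) (hm : ∑ v : V, m v = 0) (F : Finset A)
    (hex : ∃ z : A → ℤ, IsDecMinOn (intFlows D f g m) F z) :
    ∃ (f' : A → WithBot ℤ) (g' : A → WithTop ℤ),
      (∀ a : A, f a ≤ f' a ∧ LowerLEUpper (f' a) (g' a) ∧ g' a ≤ g a) ∧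
      (∀ e ∈ F, ∃ k l : ℤ, f' e = (k : WithBot ℤ) ∧ g' e = (l : WithTop ℤ) ∧
        0 ≤ l - k ∧ l - k ≤ 1) ∧
      ∀ z : A → ℤ, IsDecMinOn (intFlows D f g m) F z ↔ z ∈ intFlows D f' g' m := by
  classical
  -- `N > |F|` is needed for comparing sequences, `N ≥ 2` for strict convexity.
  obtain ⟨N, hN2, hNF⟩ : ∃ N : ℝ, 2 ≤ N ∧ (F.card : ℝ) < N :=
    ⟨F.card + 2, by linarith [F.card.cast_nonneg (α := ℝ)], by linarith⟩
  let φ : A → ℤ → ℝ := fun a k => if a ∈ F then N ^ k else 0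
  have hdec (z : A → ℤ) : IsDecMinOn (intFlows D f g m) F z ↔ z ∈ intFlows D f g m ∧
      ∀ y ∈ intFlows D f g m, ∑ a, φ a (z a) ≤ ∑ a, φ a (y a) := by
    simp only [IsDecMinOn, decSmallerOn_iff (by linarith : 1 ≤ N) hNF, not_lt, φ,
      Finset.sum_ite_mem, Finset.univ_inter]
  have hφ (a : A) (k : ℤ) : 2 * φ a k ≤ φ a (k + 1) + φ a (k - 1) := by
    by_cases ha : a ∈ F
    · simpa [φ, ha] using (two_mul_zpow_lt hN2 k).le
    · simp [φ, ha]
  obtain ⟨z, hz⟩ := hex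
  obtain ⟨hzQ, hopt⟩ := (hdec z).1 hz
  obtain ⟨π, hπ⟩ := exists_potential D.arcSrc D.arcTgt (DiGr.residual f g z) (DiGr.arcCost φ z)
    (fun u l h hl => D.residual_closed_walk_nonneg hφ hzQ hopt h hl)
  -- The reduced cost.
  let ψ : A → ℤ → ℝ := fun a k => φ a k + (π (D.tail a) - π (D.head a)) * k
  have hψsum (x : A → ℤ) (hx : D.IsModFlow m x) :
      ∑ a, ψ a (x a) = ∑ a, φ a (x a) - ∑ v, π v * m v := by
    rw [Finset.sum_add_distrib, D.sum_potential_mul hx, sub_eq_add_neg]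
  have hsucc (a : A) (h : ((z a + 1 : ℤ) : WithTop ℤ) ≤ g a) : ψ a (z a) ≤ ψ a (z a + 1) := by
    have := hπ (a, true) h
    simp only [DiGr.arcSrc, DiGr.arcTgt, DiGr.arcCost, if_true] at this
    simp only [ψ]
    push_cast
    linarith
  have hpred (a : A) (h : f a ≤ ((z a - 1 : ℤ) : WithBot ℤ)) : ψ a (z a) ≤ ψ a (z a - 1) := by
    have := hπ (a, false) (by simpa [DiGr.residual] using h)
    simp only [DiGr.arcSrc, DiGr.arcTgt, DiGr.arcCost, Bool.false_eq_true, if_false] at this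
    simp only [ψ]
    push_cast
    linarith
  have hedge (a : A) : ∃ (f' : WithBot ℤ) (g' : WithTop ℤ),
      (f a ≤ f' ∧ LowerLEUpper f' g' ∧ g' ≤ g a) ∧
      (a ∈ F → ∃ k l : ℤ, f' = (k : WithBot ℤ) ∧ g' = (l : WithTop ℤ) ∧ 0 ≤ l - k ∧ l - k ≤ 1) ∧
      ∀ x : ℤ, f a ≤ (x : WithBot ℤ) → (x : WithTop ℤ) ≤ g a → ψ a (z a) ≤ ψ a x ∧
        (ψ a x = ψ a (z a) ↔ f' ≤ (x : WithBot ℤ) ∧ (x : WithTop ℤ) ≤ g') := by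
    by_cases ha : a ∈ F
    · obtain ⟨k, l, hk, hl, hkl, hlk, h⟩ := exists_argmin_interval (ψ := ψ a) (z := z a)
        (fun k => by
          have := two_mul_zpow_lt hN2 k
          simp only [ψ, φ, ha, if_true]
          push_cast
          linarith) (hzQ.2 a).1 (hzQ.2 a).2 (hsucc a) (hpred a)
      refine ⟨k, l, ⟨hk, fun i j hi hj => ?_, hl⟩,
        fun _ => ⟨k, l, rfl, rfl, by omega, hlk⟩, fun x hfx hxg => ?_⟩
      · rwa [← WithBot.coe_injective hi, ← WithTop.coe_injective hj]
      · simpa only [WithBot.coe_le_coe, WithTop.coe_le_coe] using h x hfx hxg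
    · have hψa (k : ℤ) : ψ a k = (π (D.tail a) - π (D.head a)) * k := by simp [ψ, φ, ha]
      have h1 := hsucc a
      have h2 := hpred a
      simp only [hψa] at h1 h2 ⊢
      obtain ⟨f', g', hf', hg', hle, h⟩ :=
        exists_argmin_interval_linear (hfg a) (hzQ.2 a).1 (hzQ.2 a).2 h1 h2
      exact ⟨f', g', ⟨hf', hle, hg'⟩, fun h => absurd h ha, h⟩
  choose f' g' hbd hF hmin using hedge
  refine ⟨f', g', hbd, hF, fun y => ?_⟩
  rw [hdec]
  constructor
  · rintro ⟨hy, hyopt⟩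
    refine ⟨hy.1, fun a => ?_⟩
    have hsum : ∑ a, ψ a (z a) = ∑ a, ψ a (y a) := by
      rw [hψsum z hzQ.1, hψsum y hy.1, le_antisymm (hyopt z hzQ) (hopt y hy)]
    -- Equal sums of termwise comparable numbers have equal terms.
    have heq := (Finset.sum_eq_sum_iff_of_le
      (fun a _ => (hmin a (y a) (hy.2 a).1 (hy.2 a).2).1)).1 hsum a (Finset.mem_univ a)
    exact (hmin a (y a) (hy.2 a).1 (hy.2 a).2).2.1 heq.symm
  · rintro ⟨hy, hybd⟩
    have hybox : IsBoxBounded f g y := fun a =>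
      ⟨(hbd a).1.trans (hybd a).1, (hybd a).2.trans (hbd a).2.2⟩
    have hsum : ∑ a, ψ a (y a) = ∑ a, ψ a (z a) := Finset.sum_congr rfl fun a _ =>
      (hmin a (y a) (hybox a).1 (hybox a).2).2.2 (hybd a)
    rw [hψsum z hzQ.1, hψsum y hy, sub_left_inj] at hsum
    exact ⟨⟨hy, hybox⟩, fun x hx => hsum.trans_le (hopt x hx)⟩
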